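/- For $n\ge 1$ let $G_n=\{1,\dots,n\}\times\{1,\dots,n\}\subset\mathbb{R}^2$ be the $n\times n$ grid, and let $\mathcal{G}(n)$ be the minimum number of circles in the Euclidean plane (with arbitrary centres and arbitrary positive radii, not necessarily equal) whose union contains $G_n$. This number is finite, and, as $n\to\infty$, $$\mathcal{G}(n)=\Omega\!\left(n^{2-\varepsilon}\right)\ \text{ for every } \varepsilon>0,\qquad\text{and}\qquad \mathcal{G}(n)=O\!\left(\frac{n^2}{\sqrt{\log n}}\right).$$ That is, for every $\varepsilon>0$ there are $c_\varepsilon>0$ and $n_\varepsilon$ with $\mathcal{G}(n)\ge c_\varepsilon n^{2-\varepsilon}$ for all $n\ge n_\varepsilon$, and there are $C>0$ and $n_0\ge 2$ with $\mathcal{G}(n)\le C n^2/\sqrt{\log n}$ for all $n\ge n_0$. -/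

import Mathlib

/-- The geometric covering number of `P` with respect to the curve type `C`: the minimum
cardinality of a set of curves from `C` whose union contains `P` (it is `⊤` when no finite set
of curves from `C` covers `P`). -/
noncomputable def geometricCoveringNumber {d : ℕ} (C : Set (Set (EuclideanSpace ℝ (Fin d))))
    (P : Set (EuclideanSpace ℝ (Fin d))) : ℕ∞ :=
  ⨅ F : {F : Set (Set (EuclideanSpace ℝ (Fin d))) // F ⊆ C ∧ P ⊆ ⋃₀ F}, F.1.encard

/-- All circles in the Euclidean plane, of arbitrary centre and arbitrary positive radius. -/
def planeCircles : Set (Set (EuclideanSpace ℝ (Fin 2))) :=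
  {c | ∃ (x : EuclideanSpace ℝ (Fin 2)) (r : ℝ), 0 < r ∧ c = Metric.sphere x r}

/-- The `n × n` grid `{1, …, n} × {1, …, n}` in the Euclidean plane. -/
def squareGrid (n : ℕ) : Set (EuclideanSpace ℝ (Fin 2)) :=
  {p | ∀ i, ∃ k : ℕ, 1 ≤ k ∧ k ≤ n ∧ p i = (k : ℝ)}

/-!
The lower bound is a pointwise bound on each circle: no circle contains more than `O(n ^ ε)` points
of the `n × n` grid (`exists_ncard_circle_inter_squareGrid_le`), so `n ^ 2` points need at least
`n ^ (2 - ε)` circles up to a constant. A circle through three grid points has a rational centre,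
with denominator polynomial in `n`; clearing denominators maps its grid points injectively to
Gaussian integers of one norm `N = O(n ^ 6)`. There are `O(N ^ ε)` of those, because each prime
power `p ^ k` exactly dividing `N` contributes a factor at most `k + 1`
(`GaussianInt.exists_ncard_norm_eq_le_rpow`).

For the upper bound, the circles centred at the origin that meet the grid are as many as the values
of `x ^ 2 + y ^ 2` on it, so it suffices that only `O(X / √(log X))` integers up to `X` are sums of
two squares (`exists_card_sumsOfTwoSquares_le`). Such an integer is `a ^ 2 * b` or `2 * a ^ 2 * b`
where all prime factors of `b` are `1` modulo `4`. For the set `S` of these `b`, which is closed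
under taking divisors, writing `log b` as a sum of the von Mangoldt function over divisors and
applying Chebyshev's bound for `ψ` gives `#(S ∩ [1, X]) * log X = O(X * A)`, where `A` is the sum
of `1 / b` over `b ∈ S ∩ [1, X]`.
Finally `A ^ 2 = O(log X)`, without any information on primes in arithmetic progressions: choosing
one Gaussian prime above each `p` yields a multiplicative map `g : S → ℤ[i]` with `norm (g b) = b`,
and `(b, c) ↦ g b * conj (g c)` is injective, so that `A ^ 2` is at most the sum of `1 / norm z`
over nonzero Gaussian integers with `norm z ≤ X ^ 2` (`sq_sum_splitNats_inv_le`).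
-/

/-! ### Gaussian integers of a given norm -/

theorem GaussianInt.finite_norm_eq (N : ℤ) : {z : GaussianInt | z.norm = N}.Finite := by
  refine ((Set.finite_Icc (-N) N).prod (Set.finite_Icc (-N) N)).preimage
    (f := fun z : GaussianInt => (z.re, z.im)) (fun z _ w _ h => ?_) |>.subset fun z hz => ?_
  · exact Zsqrtd.ext (congrArg Prod.fst h) (congrArg Prod.snd h)
  · have h : z.re * z.re + z.im * z.im = N := by
      have : z.norm = N := hz
      rw [Zsqrtd.norm_def] at this
      linarith
    simp only [Set.mem_preimage, Set.mem_prod, Set.mem_Icc]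
    refine ⟨⟨?_, ?_⟩, ?_, ?_⟩ <;> nlinarith [mul_self_nonneg z.re, mul_self_nonneg z.im,
      Int.le_self_sq z.re, Int.le_self_sq z.im, Int.le_self_sq (-z.re), Int.le_self_sq (-z.im)]

theorem GaussianInt.exists_prime_dvd_natCast {p : ℕ} (hp : p.Prime) :
    ∃ q : GaussianInt, Prime q ∧ q ∣ (p : GaussianInt) := by
  have h0 : (p : GaussianInt) ≠ 0 := by exact_mod_cast hp.ne_zero
  have hu : ¬ IsUnit (p : GaussianInt) := by
    rw [← Zsqrtd.norm_eq_one_iff, Zsqrtd.norm_natCast]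
    intro h
    have : p * p = 1 := by exact_mod_cast h
    nlinarith [hp.one_lt]
  obtain ⟨q, hq, hd⟩ := WfDvdMonoid.exists_irreducible_factor hu h0
  exact ⟨q, hq.prime, hd⟩

theorem GaussianInt.exists_norm_eq_prime_pow {p : ℕ} (hp : p.Prime) {q : GaussianInt}
    (hq : Prime q) (hqp : q ∣ (p : GaussianInt)) : ∃ e : ℕ, 0 < e ∧ q.norm = (p : ℤ) ^ e := by
  obtain ⟨t, ht⟩ := hqp
  have hn : q.norm.natAbs * t.norm.natAbs = p ^ 2 := by
    rw [← Int.natAbs_mul, ← Zsqrtd.norm_mul, ← ht, Zsqrtd.norm_natCast]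
    simp [Int.natAbs_mul, sq]
  obtain ⟨e, -, he⟩ := (Nat.dvd_prime_pow hp).1 (Dvd.intro _ hn)
  refine ⟨e, Nat.pos_of_ne_zero ?_, ?_⟩
  · rintro rfl
    exact hq.not_isUnit (Zsqrtd.norm_eq_one_iff.1 (by simpa using he))
  · rw [← GaussianInt.abs_natCast_norm, he]
    push_cast
    rfl

/-- The `p`-part of a Gaussian integer is, up to the cofactor, a product of powers of a fixed
prime `q` above `p` and of its conjugate. -/
theorem GaussianInt.exists_eq_prime_pow_mul {p : ℕ} (hp : p.Prime) {q : GaussianInt}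
    (hq : Prime q) (hqp : q ∣ (p : GaussianInt)) {e : ℕ} (he0 : 0 < e)
    (he : q.norm = (p : ℤ) ^ e) {m : ℕ} (hm : ¬ p ∣ m) (k : ℕ) :
    ∀ z : GaussianInt, z.norm = ((p ^ k * m : ℕ) : ℤ) →
      ∃ a b : ℕ, ∃ w : GaussianInt, e * (a + b) = k ∧ w.norm = m ∧ z = q ^ a * star q ^ b * w := by
  induction k using Nat.strong_induction_on with
  | _ k ih =>
    intro z hz
    rcases Nat.eq_zero_or_pos k with rfl | hk
    · exact ⟨0, 0, z, by simp, by simpa using hz, by simp⟩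
    have peel : ∀ q' z' : GaussianInt, q'.norm = (p : ℤ) ^ e → z = q' * z' →
        e ≤ k ∧ z'.norm = ((p ^ (k - e) * m : ℕ) : ℤ) := by
      intro q' z' hq' hzz
      have h1 : p ^ e * z'.norm.natAbs = p ^ k * m := by
        have := hz
        rw [hzz, Zsqrtd.norm_mul, hq', ← GaussianInt.abs_natCast_norm z'] at this
        exact_mod_cast this
      have hek : e ≤ k := by
        have : p ^ e ∣ p ^ k :=
          ((Nat.Prime.coprime_iff_not_dvd hp).2 hm |>.pow_left e).dvd_of_dvd_mul_right
            (Dvd.intro _ h1)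
        exact (Nat.pow_dvd_pow_iff_le_right hp.one_lt).1 this
      refine ⟨hek, ?_⟩
      rw [← GaussianInt.abs_natCast_norm z']
      congr 1
      apply Nat.eq_of_mul_eq_mul_left (pow_pos hp.pos e)
      rw [h1, ← mul_assoc, ← pow_add, Nat.add_sub_cancel' hek]
    have hdiv : q ∣ z * star z := by
      rw [← Zsqrtd.norm_eq_mul_conj, hz]
      refine hqp.trans ?_
      have : p ∣ p ^ k * m := (dvd_pow_self p hk.ne').mul_right m
      simpa using Nat.cast_dvd_cast (α := GaussianInt) this
    rcases hq.dvd_or_dvd hdiv with ⟨z', h⟩ | ⟨z', h⟩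
    · obtain ⟨hek, hz'⟩ := peel q z' he h
      obtain ⟨a, b, w, h1, h2, h3⟩ := ih (k - e) (by omega) z' hz'
      exact ⟨a + 1, b, w, by rw [show a + 1 + b = a + b + 1 by ring, mul_add, h1]; omega, h2,
        by rw [h, h3]; ring⟩
    · have h' : z = star q * star z' := by
        rw [← star_star z, h, star_mul, mul_comm]
      obtain ⟨hek, hz'⟩ := peel (star q) (star z') (by rw [Zsqrtd.norm_conj, he]) h'
      obtain ⟨a, b, w, h1, h2, h3⟩ := ih (k - e) (by omega) _ hz'
      exact ⟨a, b + 1, w, by rw [← add_assoc, mul_add, h1]; omega, h2,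
        by rw [h', h3]; ring⟩

theorem GaussianInt.ncard_norm_eq_prime_pow_mul_le {p : ℕ} (hp : p.Prime) {m : ℕ} (hm : ¬ p ∣ m)
    (k : ℕ) : {z : GaussianInt | z.norm = ((p ^ k * m : ℕ) : ℤ)}.ncard ≤
      (k + 1) * {z : GaussianInt | z.norm = (m : ℤ)}.ncard := by
  obtain ⟨q, hq, hqp⟩ := GaussianInt.exists_prime_dvd_natCast hp
  obtain ⟨e, he0, he⟩ := GaussianInt.exists_norm_eq_prime_pow hp hq hqp
  have hsub : {z : GaussianInt | z.norm = ((p ^ k * m : ℕ) : ℤ)} ⊆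
      (fun x : ℕ × GaussianInt => q ^ x.1 * star q ^ (k / e - x.1) * x.2) ''
        ((Finset.range (k + 1) : Set ℕ) ×ˢ {z : GaussianInt | z.norm = (m : ℤ)}) := by
    intro z hz
    obtain ⟨a, b, w, h1, h2, h3⟩ := GaussianInt.exists_eq_prime_pow_mul hp hq hqp he0 he hm k z hz
    refine ⟨(a, w), ⟨?_, h2⟩, ?_⟩
    · simp only [Finset.coe_range, Set.mem_Iio]
      nlinarith
    · have : k / e - a = b := by
        rw [← h1, Nat.mul_div_cancel_left _ he0]
        omega
      simp only [this, h3]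
  have hfin : ((Finset.range (k + 1) : Set ℕ) ×ˢ {z : GaussianInt | z.norm = (m : ℤ)}).Finite :=
    (Finset.finite_toSet _).prod (GaussianInt.finite_norm_eq m)
  calc _ ≤ _ := Set.ncard_le_ncard hsub (hfin.image _)
    _ ≤ _ := Set.ncard_image_le hfin
    _ = _ := by rw [Set.ncard_prod, Set.ncard_coe_finset, Finset.card_range]

theorem GaussianInt.ncard_norm_eq_one_le : {z : GaussianInt | z.norm = 1}.ncard ≤ 9 := by
  have hsub : {z : GaussianInt | z.norm = 1} ⊆
      (fun x : ℤ × ℤ => (⟨x.1, x.2⟩ : GaussianInt)) ''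
        ((Finset.Icc (-1 : ℤ) 1 ×ˢ Finset.Icc (-1 : ℤ) 1 : Finset (ℤ × ℤ)) : Set (ℤ × ℤ)) := by
    intro z hz
    have h : z.re * z.re + z.im * z.im = 1 := by
      have : z.norm = 1 := hz
      rw [Zsqrtd.norm_def] at this
      linarith
    refine ⟨(z.re, z.im), ?_, rfl⟩
    simp only [Finset.coe_product, Finset.coe_Icc, Set.mem_prod, Set.mem_Icc]
    refine ⟨⟨?_, ?_⟩, ?_, ?_⟩ <;> nlinarith [mul_self_nonneg z.re, mul_self_nonneg z.im]
  refine (Set.ncard_le_ncard hsub ((Finset.finite_toSet _).image _)).trans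
    ((Set.ncard_image_le (Finset.finite_toSet _)).trans ?_)
  rw [Set.ncard_coe_finset]
  decide

/-- The number of Gaussian integers of norm `N` is `O(N ^ ε)`. It grows like the number of
divisors: a prime power `p ^ k` contributes a factor `k + 1`, which is at most `(p ^ k) ^ ε` unless
`p` is one of the finitely many primes below `2 ^ (1 / ε)`, and at most a constant times it
always. -/
theorem GaussianInt.exists_ncard_norm_eq_le_rpow {ε : ℝ} (hε : 0 < ε) :
    ∃ C : ℝ, 1 ≤ C ∧ ∀ N : ℕ, 0 < N →
      ({z : GaussianInt | z.norm = (N : ℤ)}.ncard : ℝ) ≤ C * (N : ℝ) ^ ε := by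
  obtain ⟨P, hP⟩ := exists_nat_gt ((2 : ℝ) ^ (1 / ε))
  set K : ℝ := max 1 (1 / (ε * Real.log 2)) with hK
  have hK1 : 1 ≤ K := le_max_left _ _
  have hlog : 0 < Real.log 2 := Real.log_pos one_lt_two
  have hεl : 0 < ε * Real.log 2 := mul_pos hε hlog
  set c : ℕ → ℝ := fun p => if p < P then K else 1 with hc
  have hc1 : ∀ p, 1 ≤ c p := fun p => by simp only [hc]; split_ifs <;> simp [hK1]
  have hcp : ∀ p k : ℕ, p.Prime → (k : ℝ) + 1 ≤ c p * ((p ^ k : ℕ) : ℝ) ^ ε := by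
    intro p k hp
    have hp2 : (2 : ℝ) ≤ p := by exact_mod_cast hp.two_le
    have hpk : ((p ^ k : ℕ) : ℝ) ^ ε = ((p : ℝ) ^ ε) ^ k := by
      push_cast
      rw [← Real.rpow_natCast, ← Real.rpow_natCast, ← Real.rpow_mul (by positivity),
        ← Real.rpow_mul (by positivity), mul_comm]
    rw [hpk]
    by_cases hpP : p < P
    · simp only [hc, if_pos hpP]
      have h1 : 1 + (k : ℝ) * (ε * Real.log 2) ≤ ((p : ℝ) ^ ε) ^ k := by
        calc 1 + (k : ℝ) * (ε * Real.log 2) ≤ Real.exp ((k : ℝ) * (ε * Real.log 2)) := by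
              linarith [Real.add_one_le_exp ((k : ℝ) * (ε * Real.log 2))]
          _ = ((2 : ℝ) ^ ε) ^ k := by
              rw [Real.rpow_def_of_pos two_pos, ← Real.exp_nat_mul, mul_comm ε]
          _ ≤ _ := by gcongr
      have h2 : 1 ≤ K * (ε * Real.log 2) := by
        have : 1 / (ε * Real.log 2) ≤ K := le_max_right _ _
        rwa [div_le_iff₀ hεl] at this
      calc (k : ℝ) + 1 ≤ K * (1 + (k : ℝ) * (ε * Real.log 2)) := by
            nlinarith [Nat.cast_nonneg (α := ℝ) k]
        _ ≤ _ := by gcongr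
    · simp only [hc, if_neg hpP, one_mul]
      have h2 : (2 : ℝ) ≤ (p : ℝ) ^ ε := by
        have hle : (2 : ℝ) ^ (1 / ε) ≤ p := hP.le.trans (by exact_mod_cast not_lt.1 hpP)
        calc (2 : ℝ) = ((2 : ℝ) ^ (1 / ε)) ^ ε := by
              rw [← Real.rpow_mul two_pos.le, one_div_mul_cancel hε.ne', Real.rpow_one]
          _ ≤ _ := by gcongr
      calc (k : ℝ) + 1 ≤ (2 : ℝ) ^ k := by exact_mod_cast Nat.lt_two_pow_self (n := k)
        _ ≤ _ := by gcongr
  have main : ∀ N : ℕ, 0 < N → ({z : GaussianInt | z.norm = (N : ℤ)}.ncard : ℝ) ≤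
      9 * (∏ p ∈ N.primeFactors, c p) * (N : ℝ) ^ ε := by
    intro N
    induction N using Nat.recOnPrimePow with
    | zero => intro h; exact absurd h (lt_irrefl 0)
    | one =>
      intro _
      simpa using (Nat.cast_le (α := ℝ)).2 GaussianInt.ncard_norm_eq_one_le
    | prime_pow_mul a p n hp hpa hn ih =>
      intro hpos
      have ha : 0 < a := Nat.pos_of_mul_pos_left hpos
      have hcop : (p ^ n).Coprime a := ((Nat.Prime.coprime_iff_not_dvd hp).2 hpa).pow_left n
      have h1 := (Nat.cast_le (α := ℝ)).2 (GaussianInt.ncard_norm_eq_prime_pow_mul_le hp hpa n)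
      rw [hcop.primeFactors_mul, Finset.prod_union hcop.disjoint_primeFactors,
        Nat.primeFactors_prime_pow hn.ne' hp, Finset.prod_singleton]
      have h2 : ((p ^ n * a : ℕ) : ℝ) ^ ε = ((p ^ n : ℕ) : ℝ) ^ ε * (a : ℝ) ^ ε := by
        rw [Nat.cast_mul, Real.mul_rpow (by positivity) (by positivity)]
      rw [h2]
      calc _ ≤ _ := h1
        _ = ((n : ℝ) + 1) * ({z : GaussianInt | z.norm = (a : ℤ)}.ncard : ℝ) := by push_cast; ring
        _ ≤ (c p * ((p ^ n : ℕ) : ℝ) ^ ε) * (9 * (∏ p ∈ a.primeFactors, c p) * (a : ℝ) ^ ε) :=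
            mul_le_mul (hcp p n hp) (ih ha) (by positivity) (le_trans (by positivity) (hcp p n hp))
        _ = _ := by ring
  refine ⟨9 * K ^ P, by nlinarith [one_le_pow₀ hK1 (n := P)], fun N hN => (main N hN).trans ?_⟩
  gcongr
  calc ∏ p ∈ N.primeFactors, c p
      = ∏ p ∈ N.primeFactors with p < P, K := by
        rw [Finset.prod_filter]
    _ = K ^ (N.primeFactors.filter (· < P)).card := by rw [Finset.prod_const]
    _ ≤ K ^ P := by
        apply pow_le_pow_right₀ hK1
        calc _ ≤ (Finset.range P).card := Finset.card_le_card fun p hp => by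
              simpa using (Finset.mem_filter.1 hp).2
          _ = P := Finset.card_range P

/-! ### Grid points on a circle -/

/-- The integer points `(a, b)` with `1 ≤ a, b ≤ n`. -/
noncomputable def integerGrid (n : ℕ) : Finset (ℤ × ℤ) :=
  Finset.Icc (1 : ℤ) n ×ˢ Finset.Icc (1 : ℤ) n

theorem squareGrid_eq_image (n : ℕ) :
    squareGrid n =
      (fun p : ℤ × ℤ => !₂[(p.1 : ℝ), (p.2 : ℝ)]) '' (integerGrid n : Set (ℤ × ℤ)) := by
  ext p
  simp only [squareGrid, Set.mem_ofPred_eq, integerGrid, Finset.coe_product, Finset.coe_Icc,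
    Set.mem_image, Set.mem_prod, Set.mem_Icc]
  constructor
  · intro h
    obtain ⟨k, hk1, hk2, hk⟩ := h 0
    obtain ⟨l, hl1, hl2, hl⟩ := h 1
    refine ⟨(k, l), ⟨⟨Nat.one_le_cast.2 hk1, Nat.cast_le.2 hk2⟩, Nat.one_le_cast.2 hl1,
      Nat.cast_le.2 hl2⟩, ?_⟩
    · ext i
      fin_cases i
      · simp [hk]
      · simp [hl]
  · rintro ⟨⟨a, b⟩, ⟨⟨ha1, ha2⟩, hb1, hb2⟩, rfl⟩ i
    simp only at ha1 ha2 hb1 hb2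
    fin_cases i
    · exact ⟨a.toNat, by omega, by omega, by
        have : ((a.toNat : ℤ) : ℝ) = a := by rw [Int.toNat_of_nonneg (by omega)]
        rw [← Int.cast_natCast, this]
        simp⟩
    · exact ⟨b.toNat, by omega, by omega, by
        have : ((b.toNat : ℤ) : ℝ) = b := by rw [Int.toNat_of_nonneg (by omega)]
        rw [← Int.cast_natCast, this]
        simp⟩

theorem injective_pointOfInt :
    Function.Injective fun p : ℤ × ℤ => (!₂[(p.1 : ℝ), (p.2 : ℝ)] : EuclideanSpace ℝ (Fin 2)) := by
  intro p q h
  have h0 := congrFun (congrArg (fun v : EuclideanSpace ℝ (Fin 2) => (v : Fin 2 → ℝ)) h) 0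
  have h1 := congrFun (congrArg (fun v : EuclideanSpace ℝ (Fin 2) => (v : Fin 2 → ℝ)) h) 1
  simp at h0 h1
  exact Prod.ext h0 h1

theorem finite_squareGrid (n : ℕ) : (squareGrid n).Finite := by
  rw [squareGrid_eq_image]
  exact (Finset.finite_toSet _).image _

theorem ncard_squareGrid (n : ℕ) : (squareGrid n).ncard = n ^ 2 := by
  rw [squareGrid_eq_image, Set.ncard_image_of_injective _ injective_pointOfInt,
    Set.ncard_coe_finset, integerGrid, Finset.card_product, Int.card_Icc, sq]
  simp

/-- Three distinct lattice points `0`, `u`, `v` on a circle with centre `(s, t)` are not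
collinear. -/
theorem det_ne_zero_of_concyclic {u₁ u₂ v₁ v₂ : ℤ} {s t : ℝ}
    (hu : 2 * (s * u₁ + t * u₂) = (u₁ : ℝ) ^ 2 + (u₂ : ℝ) ^ 2)
    (hv : 2 * (s * v₁ + t * v₂) = (v₁ : ℝ) ^ 2 + (v₂ : ℝ) ^ 2)
    (hu0 : 0 < u₁ ^ 2 + u₂ ^ 2) (hv0 : 0 < v₁ ^ 2 + v₂ ^ 2) (huv : u₁ = v₁ → u₂ ≠ v₂) :
    u₁ * v₂ - u₂ * v₁ ≠ 0 := by
  intro hD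
  have hD' : (u₁ : ℝ) * v₂ - u₂ * v₁ = 0 := by exact_mod_cast hD
  have h1 : u₁ * (v₁ ^ 2 + v₂ ^ 2) = v₁ * (u₁ ^ 2 + u₂ ^ 2) := by
    have : (u₁ : ℝ) * ((v₁ : ℝ) ^ 2 + (v₂ : ℝ) ^ 2) = v₁ * ((u₁ : ℝ) ^ 2 + (u₂ : ℝ) ^ 2) := by
      linear_combination v₁ * hu - u₁ * hv + 2 * t * hD'
    exact_mod_cast this
  have h2 : u₂ * (v₁ ^ 2 + v₂ ^ 2) = v₂ * (u₁ ^ 2 + u₂ ^ 2) := by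
    have : (u₂ : ℝ) * ((v₁ : ℝ) ^ 2 + (v₂ : ℝ) ^ 2) = v₂ * ((u₁ : ℝ) ^ 2 + (u₂ : ℝ) ^ 2) := by
      linear_combination v₂ * hu - u₂ * hv - 2 * s * hD'
    exact_mod_cast this
  have h3 : v₁ ^ 2 + v₂ ^ 2 = u₁ ^ 2 + u₂ ^ 2 := by
    apply mul_left_cancel₀ (mul_pos hu0 hv0).ne'
    linear_combination (u₁ * (v₁ ^ 2 + v₂ ^ 2) + v₁ * (u₁ ^ 2 + u₂ ^ 2)) * h1 +
      (u₂ * (v₁ ^ 2 + v₂ ^ 2) + v₂ * (u₁ ^ 2 + u₂ ^ 2)) * h2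
  rw [h3] at h1 h2
  exact huv (mul_right_cancel₀ hu0.ne' h1) (mul_right_cancel₀ hu0.ne' h2)

/-- A circle through three grid points has its centre at a point with denominator `2 * D`, where `D`
is the determinant of two difference vectors; scaling by `2 * D` turns its lattice points into
Gaussian integers of a fixed norm, polynomially bounded in `n`. -/
theorem card_le_two_or_le_ncard_norm_eq {n : ℕ} {S : Finset (ℤ × ℤ)} (hS : S ⊆ integerGrid n)
    {x y r : ℝ} (hr : ∀ p ∈ S, ((p.1 : ℝ) - x) ^ 2 + ((p.2 : ℝ) - y) ^ 2 = r) :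
    S.card ≤ 2 ∨ ∃ N : ℕ, 0 < N ∧ N ≤ 32 * n ^ 6 ∧
      S.card ≤ {z : GaussianInt | z.norm = (N : ℤ)}.ncard := by
  rw [or_iff_not_imp_left, not_le, Finset.two_lt_card_iff]
  rintro ⟨⟨a₁, a₂⟩, ⟨b₁, b₂⟩, ⟨c₁, c₂⟩, ha, hb, hc, hab, hac, hbc⟩
  have hbd : ∀ p ∈ S, (1 ≤ p.1 ∧ p.1 ≤ n) ∧ 1 ≤ p.2 ∧ p.2 ≤ n := by
    intro p hp
    simpa [integerGrid] using hS hp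
  -- the equation of the circle, relative to its point `(a₁, a₂)` as origin
  have hrel : ∀ p ∈ S, 2 * ((x - a₁) * ((p.1 - a₁ : ℤ) : ℝ) + (y - a₂) * ((p.2 - a₂ : ℤ) : ℝ)) =
      ((p.1 - a₁ : ℤ) : ℝ) ^ 2 + ((p.2 - a₂ : ℤ) : ℝ) ^ 2 := by
    intro p hp
    have h1 := hr p hp
    have h2 := hr _ ha
    simp only at h2
    push_cast
    linear_combination h2 - h1
  have hpos : ∀ p : ℤ × ℤ, p ≠ (a₁, a₂) → 0 < (p.1 - a₁) ^ 2 + (p.2 - a₂) ^ 2 := by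
    intro p hp
    by_contra hle
    apply hp
    have h1 : (p.1 - a₁) ^ 2 = 0 := by nlinarith [sq_nonneg (p.1 - a₁), sq_nonneg (p.2 - a₂)]
    have h2 : (p.2 - a₂) ^ 2 = 0 := by nlinarith [sq_nonneg (p.1 - a₁), sq_nonneg (p.2 - a₂)]
    exact Prod.ext (sub_eq_zero.1 (pow_eq_zero_iff two_ne_zero |>.1 h1))
      (sub_eq_zero.1 (pow_eq_zero_iff two_ne_zero |>.1 h2))
  have hu := hrel _ hb
  have hv := hrel _ hc
  have hu0 := hpos _ hab.symm
  have hv0 := hpos _ hac.symm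
  obtain ⟨⟨ha1, ha2⟩, ha3, ha4⟩ := hbd _ ha
  obtain ⟨⟨hb1, hb2⟩, hb3, hb4⟩ := hbd _ hb
  obtain ⟨⟨hc1, hc2⟩, hc3, hc4⟩ := hbd _ hc
  simp only at hu hv hu0 hv0 ha1 ha2 ha3 ha4 hb1 hb2 hb3 hb4 hc1 hc2 hc3 hc4
  have hu1 : |b₁ - a₁| ≤ n := abs_le.2 ⟨by omega, by omega⟩
  have hu2 : |b₂ - a₂| ≤ n := abs_le.2 ⟨by omega, by omega⟩
  have hv1 : |c₁ - a₁| ≤ n := abs_le.2 ⟨by omega, by omega⟩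
  have hv2 : |c₂ - a₂| ≤ n := abs_le.2 ⟨by omega, by omega⟩
  have hne : b₁ - a₁ = c₁ - a₁ → b₂ - a₂ ≠ c₂ - a₂ := by
    intro h1 h2
    exact hbc (Prod.ext (sub_left_injective h1) (sub_left_injective h2))
  generalize b₁ - a₁ = u₁ at *
  generalize b₂ - a₂ = u₂ at *
  generalize c₁ - a₁ = v₁ at *
  generalize c₂ - a₂ = v₂ at *
  have hD := det_ne_zero_of_concyclic hu hv hu0 hv0 hne
  set D := u₁ * v₂ - u₂ * v₁ with hDdef
  -- `w = 2 * D * (centre)`, by Cramer's rule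
  set w₁ := (u₁ ^ 2 + u₂ ^ 2) * v₂ - (v₁ ^ 2 + v₂ ^ 2) * u₂ with hw₁
  set w₂ := (v₁ ^ 2 + v₂ ^ 2) * u₁ - (u₁ ^ 2 + u₂ ^ 2) * v₁ with hw₂
  have hcramer : ∀ p ∈ S, D * ((p.1 - a₁) ^ 2 + (p.2 - a₂) ^ 2) =
      w₁ * (p.1 - a₁) + w₂ * (p.2 - a₂) := by
    intro p hp
    have h1 : (w₁ : ℝ) = 2 * D * (x - a₁) := by
      rw [hw₁, hDdef]
      push_cast
      linear_combination u₂ * hv - v₂ * hu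
    have h2 : (w₂ : ℝ) = 2 * D * (y - a₂) := by
      rw [hw₂, hDdef]
      push_cast
      linear_combination v₁ * hu - u₁ * hv
    have h3 := hrel p hp
    have : (D : ℝ) * (((p.1 - a₁ : ℤ) : ℝ) ^ 2 + ((p.2 - a₂ : ℤ) : ℝ) ^ 2) =
        w₁ * ((p.1 - a₁ : ℤ) : ℝ) + w₂ * ((p.2 - a₂ : ℤ) : ℝ) := by
      rw [h1, h2]
      linear_combination (-(D : ℝ)) * h3
    exact_mod_cast this
  have hsq : ∀ a b : ℤ, |a| ≤ n → |b| ≤ n → a ^ 2 + b ^ 2 ≤ 2 * (n : ℤ) ^ 2 := by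
    intro a b h1 h2
    have h1' := sq_le_sq' (neg_le_of_abs_le h1) (le_of_abs_le h1)
    have h2' := sq_le_sq' (neg_le_of_abs_le h2) (le_of_abs_le h2)
    linarith
  have hw : ∀ A B a b : ℤ, 0 < A → 0 < B → A ≤ 2 * (n : ℤ) ^ 2 → B ≤ 2 * (n : ℤ) ^ 2 → |a| ≤ n →
      |b| ≤ n → (A * a - B * b) ^ 2 ≤ 16 * (n : ℤ) ^ 6 := by
    intro A B a b hA hB hA' hB' h1 h2
    have h : |A * a - B * b| ≤ 4 * (n : ℤ) ^ 3 := by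
      calc |A * a - B * b| ≤ |A * a| + |B * b| := abs_sub _ _
        _ = A * |a| + B * |b| := by rw [abs_mul, abs_mul, abs_of_pos hA, abs_of_pos hB]
        _ ≤ 2 * (n : ℤ) ^ 2 * n + 2 * (n : ℤ) ^ 2 * n := by gcongr
        _ = _ := by ring
    calc _ ≤ (4 * (n : ℤ) ^ 3) ^ 2 := sq_le_sq' (neg_le_of_abs_le h) (le_of_abs_le h)
      _ = _ := by ring
  have hwN : w₁ ^ 2 + w₂ ^ 2 ≤ 32 * (n : ℤ) ^ 6 := by
    have h1 := hw _ _ v₂ u₂ hu0 hv0 (hsq _ _ hu1 hu2) (hsq _ _ hv1 hv2) hv2 hu2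
    have h2 := hw _ _ u₁ v₁ hv0 hu0 (hsq _ _ hv1 hv2) (hsq _ _ hu1 hu2) hu1 hv1
    linarith only [h1, h2]
  clear_value w₁ w₂ D
  have hN0 : 0 ≤ w₁ ^ 2 + w₂ ^ 2 := by positivity
  have hNcast : ((w₁ ^ 2 + w₂ ^ 2).toNat : ℤ) = w₁ ^ 2 + w₂ ^ 2 := Int.toNat_of_nonneg hN0
  refine ⟨(w₁ ^ 2 + w₂ ^ 2).toNat, ?_, ?_, ?_⟩
  · by_contra hle
    have h0 : w₁ ^ 2 + w₂ ^ 2 = 0 := by omega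
    obtain ⟨h1, h2⟩ := (add_eq_zero_iff_of_nonneg (sq_nonneg w₁) (sq_nonneg w₂)).1 h0
    rw [sq_eq_zero_iff] at h1 h2
    have h3 := hcramer _ hb
    rw [h1, h2, zero_mul, zero_mul, add_zero] at h3
    exact (mul_ne_zero hD (hpos _ hab.symm).ne') h3
  · zify
    rw [hNcast]
    exact hwN
  · rw [hNcast, ← Set.ncard_coe_finset]
    refine Set.ncard_le_ncard_of_injOn
      (fun p => (⟨2 * D * (p.1 - a₁) - w₁, 2 * D * (p.2 - a₂) - w₂⟩ : GaussianInt))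
      (fun p hp => ?_) (fun p _ q _ h => ?_) (GaussianInt.finite_norm_eq _)
    · rw [Set.mem_ofPred_eq, Zsqrtd.norm_def]
      linear_combination (4 * D) * hcramer p hp
    · have h1 := congrArg Zsqrtd.re h
      have h2 := congrArg Zsqrtd.im h
      simp only at h1 h2
      have h2D : 2 * D ≠ 0 := mul_ne_zero two_ne_zero hD
      refine Prod.ext ?_ ?_
      · have := mul_left_cancel₀ h2D (sub_left_injective h1)
        linarith
      · have := mul_left_cancel₀ h2D (sub_left_injective h2)
        linarith

theorem exists_ncard_circle_inter_squareGrid_le {ε : ℝ} (hε : 0 < ε) :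
    ∃ C : ℝ, 0 < C ∧ ∀ n : ℕ, 1 ≤ n → ∀ c ∈ planeCircles,
      ((c ∩ squareGrid n).ncard : ℝ) ≤ C * (n : ℝ) ^ ε := by
  -- the norm that occurs is `O(n ^ 6)`
  obtain ⟨C, hC1, hC⟩ := GaussianInt.exists_ncard_norm_eq_le_rpow (show 0 < ε / 6 by positivity)
  refine ⟨2 + C * 32 ^ (ε / 6), by positivity, ?_⟩
  rintro n hn _ ⟨x, r, hr, rfl⟩
  have hn1 : (1 : ℝ) ≤ n := by exact_mod_cast hn
  have hnε : (1 : ℝ) ≤ (n : ℝ) ^ ε := Real.one_le_rpow hn1 hε.le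
  set f : ℤ × ℤ → EuclideanSpace ℝ (Fin 2) := fun p => !₂[(p.1 : ℝ), (p.2 : ℝ)] with hf
  classical
  set S := (integerGrid n).filter fun p => f p ∈ Metric.sphere x r with hS
  have himg : Metric.sphere x r ∩ squareGrid n = f '' (S : Set (ℤ × ℤ)) := by
    rw [squareGrid_eq_image]
    ext p
    simp only [hS, Finset.coe_filter, Set.mem_inter_iff, Set.mem_image, Set.mem_ofPred_eq]
    constructor
    · rintro ⟨h1, q, hq, rfl⟩
      exact ⟨q, ⟨hq, h1⟩, rfl⟩
    · rintro ⟨q, ⟨hq, h1⟩, rfl⟩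
      exact ⟨h1, q, hq, rfl⟩
  rw [himg, Set.ncard_image_of_injective _ injective_pointOfInt, Set.ncard_coe_finset]
  have hcirc : ∀ p ∈ S, ((p.1 : ℝ) - x 0) ^ 2 + ((p.2 : ℝ) - x 1) ^ 2 = r ^ 2 := by
    intro p hp
    have h := (Finset.mem_filter.1 hp).2
    rw [Metric.mem_sphere, EuclideanSpace.dist_eq, Fin.sum_univ_two] at h
    rw [← h, Real.sq_sqrt (by positivity)]
    simp [hf, Real.dist_eq, sq_abs]
  rcases card_le_two_or_le_ncard_norm_eq (Finset.filter_subset _ _) hcirc with h | ⟨N, hN, hN', h⟩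
  · have h2 : (S.card : ℝ) ≤ 2 := by exact_mod_cast h
    have : 0 ≤ C * 32 ^ (ε / 6) := by positivity
    nlinarith
  · calc (S.card : ℝ) ≤ ({z : GaussianInt | z.norm = (N : ℤ)}.ncard : ℝ) := by exact_mod_cast h
      _ ≤ C * (N : ℝ) ^ (ε / 6) := hC N hN
      _ ≤ C * (32 * (n : ℝ) ^ 6) ^ (ε / 6) := by
          gcongr
          exact_mod_cast hN'
      _ = C * 32 ^ (ε / 6) * (n : ℝ) ^ ε := by
          rw [Real.mul_rpow (by positivity) (by positivity), ← Real.rpow_natCast, ← Real.rpow_mul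
            (by positivity), mul_assoc]
          congr 3
          push_cast
          ring
      _ ≤ _ := by nlinarith

/-- If no circle contains more than `M` points of the grid, at least `n ^ 2 / M` circles are needed
to cover it. -/
theorem sq_le_encard_toNat_mul {n : ℕ} {M : ℝ}
    (hcirc : ∀ c ∈ planeCircles, ((c ∩ squareGrid n).ncard : ℝ) ≤ M)
    (hfin : geometricCoveringNumber planeCircles (squareGrid n) ≠ ⊤) :
    (n : ℝ) ^ 2 ≤ ((geometricCoveringNumber planeCircles (squareGrid n)).toNat : ℝ) * M := by
  have hne : Nonempty {F : Set (Set (EuclideanSpace ℝ (Fin 2))) //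
      F ⊆ planeCircles ∧ squareGrid n ⊆ ⋃₀ F} := by
    by_contra h
    rw [not_nonempty_iff] at h
    exact hfin (by rw [geometricCoveringNumber, iInf_of_empty])
  obtain ⟨⟨F, hF, hcov⟩, hFeq⟩ := ENat.exists_eq_iInf
    fun F : {F : Set (Set (EuclideanSpace ℝ (Fin 2))) //
      F ⊆ planeCircles ∧ squareGrid n ⊆ ⋃₀ F} => F.1.encard
  change F.encard = geometricCoveringNumber planeCircles (squareGrid n) at hFeq
  rw [← hFeq] at hfin ⊢
  have hFfin : F.Finite := Set.encard_ne_top_iff.1 hfin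
  have hcard : (squareGrid n).ncard ≤ ∑ c ∈ hFfin.toFinset, (c ∩ squareGrid n).ncard := by
    refine le_trans (Set.ncard_le_ncard (t := ⋃ c ∈ hFfin.toFinset, c ∩ squareGrid n) ?_ ?_)
      (Finset.set_ncard_biUnion_le _ _)
    · intro p hp
      obtain ⟨c, hc, hpc⟩ := hcov hp
      simp only [Set.Finite.mem_toFinset, Set.mem_iUnion]
      exact ⟨c, hc, hpc, hp⟩
    · exact (finite_squareGrid n).subset (Set.iUnion₂_subset fun c _ => Set.inter_subset_right)
  rw [ncard_squareGrid] at hcard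
  calc (n : ℝ) ^ 2 ≤ ∑ c ∈ hFfin.toFinset, ((c ∩ squareGrid n).ncard : ℝ) := by exact_mod_cast hcard
    _ ≤ ∑ c ∈ hFfin.toFinset, M :=
        Finset.sum_le_sum fun c hc => hcirc c (hF (hFfin.mem_toFinset.1 hc))
    _ = _ := by
        rw [Finset.sum_const, nsmul_eq_mul, ← Set.ncard_eq_toFinset_card F hFfin, Set.ncard]

/-! ### Integers composed of primes congruent to `1` modulo `4` -/

/-- The natural number `m` is positive and all its prime factors are `1` modulo `4`. -/
def IsSplitNat (m : ℕ) : Prop :=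
  m ≠ 0 ∧ ∀ p : ℕ, p.Prime → p ∣ m → p % 4 = 1

open Classical in
/-- A Gaussian integer of norm `p`, where `p` is a prime congruent to `1` modulo `4`; the value at
other arguments is irrelevant. -/
noncomputable def gaussianPrimeAbove (p : ℕ) : GaussianInt :=
  if h : ∃ z : GaussianInt, z.norm = (p : ℤ) then h.choose else 0

/-- The completely multiplicative lift to `ℤ[i]` that sends a prime `p` to
`gaussianPrimeAbove p`. -/
noncomputable def gaussianLift (m : ℕ) : GaussianInt :=
  (m.primeFactorsList.map gaussianPrimeAbove).prod

theorem norm_gaussianPrimeAbove {p : ℕ} (hp : p.Prime) (h4 : p % 4 = 1) :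
    (gaussianPrimeAbove p).norm = (p : ℤ) := by
  have h : ∃ z : GaussianInt, z.norm = (p : ℤ) := by
    have := Fact.mk hp
    obtain ⟨a, b, hab⟩ := Nat.Prime.sq_add_sq (p := p) (by omega)
    refine ⟨⟨a, b⟩, ?_⟩
    rw [Zsqrtd.norm_def]
    zify at hab
    linarith
  rw [gaussianPrimeAbove, dif_pos h]
  exact h.choose_spec

theorem norm_gaussianLift {m : ℕ} (hm : IsSplitNat m) : (gaussianLift m).norm = (m : ℤ) := by
  have key : ∀ l : List ℕ, (∀ p ∈ l, p.Prime ∧ p % 4 = 1) →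
      ((l.map gaussianPrimeAbove).prod).norm = (l.prod : ℤ) := by
    intro l
    induction l with
    | nil => simp
    | cons p l ih =>
      intro h
      have hp := h p (by simp)
      rw [List.map_cons, List.prod_cons, Zsqrtd.norm_mul, norm_gaussianPrimeAbove hp.1 hp.2,
        ih fun q hq => h q (by simp [hq]), List.prod_cons, Nat.cast_mul]
  rw [gaussianLift, key _ fun p hp => ⟨Nat.prime_of_mem_primeFactorsList hp,
    hm.2 p (Nat.prime_of_mem_primeFactorsList hp) (Nat.dvd_of_mem_primeFactorsList hp)⟩,
    Nat.prod_primeFactorsList hm.1]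

theorem GaussianInt.isCoprime_of_isCoprime_norm {z w : GaussianInt}
    (h : IsCoprime z.norm w.norm) : IsCoprime z w := by
  have h' : IsCoprime ((z.norm : ℤ) : GaussianInt) ((w.norm : ℤ) : GaussianInt) :=
    h.map (Int.castRingHom GaussianInt)
  rw [Zsqrtd.norm_eq_mul_conj, Zsqrtd.norm_eq_mul_conj] at h'
  exact h'.of_mul_left_left.of_mul_right_left

/-- Distinct primes have coprime norms; and `p = z * conj z` is unramified, because a common
factor of `z = a + b i` and its conjugate divides `2 a` and `p`, which are coprime. -/
theorem isCoprime_gaussianPrimeAbove_star {p q : ℕ} (hp : p.Prime) (hp4 : p % 4 = 1)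
    (hq : q.Prime) (hq4 : q % 4 = 1) :
    IsCoprime (gaussianPrimeAbove p) (star (gaussianPrimeAbove q)) := by
  by_cases hpq : p = q
  · subst hpq
    set z := gaussianPrimeAbove p with hz
    have hn : z.re * z.re + z.im * z.im = p := by
      have := norm_gaussianPrimeAbove hp hp4
      rw [← hz, Zsqrtd.norm_def] at this
      linarith
    have hcop : IsCoprime (p : ℤ) (2 * z.re) := by
      rw [(Nat.prime_iff_prime_int.1 hp).irreducible.coprime_iff_not_dvd]
      intro hd
      rcases (Nat.prime_iff_prime_int.1 hp).dvd_or_dvd hd with h2 | ⟨t, ht⟩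
      · have := Nat.le_of_dvd two_pos (by exact_mod_cast h2 : p ∣ 2)
        have := hp.two_le
        omega
      · have hp0 : (1 : ℤ) < p := by exact_mod_cast hp.one_lt
        have ht0 : t = 0 := by
          by_contra h0
          have : 1 ≤ t * t := by
            have := mul_self_pos.2 h0
            omega
          have h2 : z.re * z.re = p * p * (t * t) := by rw [ht]; ring
          nlinarith [mul_self_nonneg z.im, mul_le_mul_of_nonneg_left this
            (mul_self_nonneg (p : ℤ))]
        rw [ht, ht0] at hn
        have hpr := Nat.prime_iff_prime_int.1 hp
        have hsq : (p : ℤ) = z.im * z.im := by rw [← hn]; ring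
        exact hpr.irreducible.not_isSquare ⟨z.im, hsq⟩
    obtain ⟨u, v, huv⟩ := hcop
    refine ⟨u * star z + v, v, ?_⟩
    have h1 : ((p : ℤ) : GaussianInt) = z * star z := by
      rw [← Zsqrtd.norm_eq_mul_conj, hz, norm_gaussianPrimeAbove hp hp4]
    have h2 : ((2 * z.re : ℤ) : GaussianInt) = z + star z := by
      ext
      · simp
        ring
      · simp
    have h3 := congrArg (fun x : ℤ => (x : GaussianInt)) huv
    simp only [Int.cast_add, Int.cast_mul u, Int.cast_mul v] at h3
    rw [h1, h2, Int.cast_one] at h3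
    rw [← h3]
    ring
  · apply GaussianInt.isCoprime_of_isCoprime_norm
    rw [Zsqrtd.norm_conj, norm_gaussianPrimeAbove hp hp4, norm_gaussianPrimeAbove hq hq4]
    exact Nat.isCoprime_iff_coprime.2 ((Nat.coprime_primes hp hq).2 hpq)

theorem isCoprime_gaussianLift_star {m n : ℕ} (hm : IsSplitNat m) (hn : IsSplitNat n) :
    IsCoprime (gaussianLift m) (star (gaussianLift n)) := by
  have right : ∀ (z : GaussianInt) (l : List ℕ),
      (∀ q ∈ l, IsCoprime z (star (gaussianPrimeAbove q))) →
      IsCoprime z (star (l.map gaussianPrimeAbove).prod) := by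
    intro z l
    induction l with
    | nil => intro _; simpa using isCoprime_one_right
    | cons q l ih =>
      intro h
      rw [List.map_cons, List.prod_cons, star_mul]
      exact (ih fun r hr => h r (by simp [hr])).mul_right (h q (by simp))
  have left : ∀ (z : GaussianInt) (l : List ℕ), (∀ q ∈ l, IsCoprime (gaussianPrimeAbove q) z) →
      IsCoprime (l.map gaussianPrimeAbove).prod z := by
    intro z l
    induction l with
    | nil => intro _; simpa using isCoprime_one_left
    | cons q l ih =>
      intro h
      rw [List.map_cons, List.prod_cons]
      exact (h q (by simp)).mul_left (ih fun r hr => h r (by simp [hr]))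
  have prime_of_mem : ∀ {k : ℕ}, IsSplitNat k → ∀ p ∈ k.primeFactorsList, p.Prime ∧ p % 4 = 1 :=
    fun hk p hp => ⟨Nat.prime_of_mem_primeFactorsList hp,
      hk.2 p (Nat.prime_of_mem_primeFactorsList hp) (Nat.dvd_of_mem_primeFactorsList hp)⟩
  refine left _ _ fun p hp => right _ _ fun q hq => ?_
  exact isCoprime_gaussianPrimeAbove_star (prime_of_mem hm p hp).1 (prime_of_mem hm p hp).2
    (prime_of_mem hn q hq).1 (prime_of_mem hn q hq).2

/-- Since `gaussianLift a` is coprime to `star (gaussianLift d)` for all `a` and `d`, the two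
factors can be recovered from their product. -/
theorem gaussianLift_mul_star_injOn :
    Set.InjOn (fun x : ℕ × ℕ => gaussianLift x.1 * star (gaussianLift x.2))
      {x | IsSplitNat x.1 ∧ IsSplitNat x.2} := by
  have key : ∀ a b c d : ℕ, IsSplitNat a → IsSplitNat b → IsSplitNat c → IsSplitNat d →
      gaussianLift a * star (gaussianLift b) = gaussianLift c * star (gaussianLift d) → a ∣ c := by
    intro a b c d ha hb hc hd h
    have h1 : gaussianLift a ∣ gaussianLift c :=
      (isCoprime_gaussianLift_star ha hd).dvd_of_dvd_mul_right (Dvd.intro _ h)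
    have h2 := map_dvd Zsqrtd.normMonoidHom h1
    simp only [Zsqrtd.normMonoidHom, MonoidHom.coe_mk, OneHom.coe_mk] at h2
    rw [norm_gaussianLift ha, norm_gaussianLift hc] at h2
    exact_mod_cast h2
  rintro ⟨a, b⟩ ⟨ha, hb⟩ ⟨c, d⟩ ⟨hc, hd⟩ h
  simp only at ha hb hc hd h
  have hac : a = c := Nat.dvd_antisymm (key a b c d ha hb hc hd h) (key c d a b hc hd ha hb h.symm)
  have h' : gaussianLift b * star (gaussianLift a) = gaussianLift d * star (gaussianLift c) := by
    have := congrArg star h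
    simpa only [star_mul, star_star] using this
  have hbd : b = d :=
    Nat.dvd_antisymm (key b a d c hb ha hd hc h') (key d c b a hd hc hb ha h'.symm)
  rw [hac, hbd]

/-! ### Counting integers composed of primes congruent to `1` modulo `4` -/

open Classical in
/-- The integers `1 ≤ m ≤ X` all of whose prime factors are `1` modulo `4`. -/
noncomputable def splitNats (X : ℕ) : Finset ℕ := {m ∈ Finset.Icc 1 X | IsSplitNat m}

theorem mem_splitNats {X m : ℕ} : m ∈ splitNats X ↔ (1 ≤ m ∧ m ≤ X) ∧ IsSplitNat m := by
  simp [splitNats]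

theorem IsSplitNat.of_dvd {m n : ℕ} (hn : IsSplitNat n) (h : m ∣ n) : IsSplitNat m :=
  ⟨ne_zero_of_dvd_ne_zero hn.1 h, fun p hp hpm => hn.2 p hp (hpm.trans h)⟩

/-- The `8 * k` lattice points of sup norm `k` have norm at least `k ^ 2`, so the sum is bounded by
eight times a harmonic sum. -/
theorem sum_inv_norm_le {X : ℕ} {Z : Finset GaussianInt}
    (hZ : ∀ z ∈ Z, 0 < z.norm ∧ z.norm ≤ (X : ℤ) ^ 2) :
    ∑ z ∈ Z, (1 : ℝ) / z.norm ≤ 8 * (1 + Real.log X) := by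
  set f : GaussianInt → ℕ := fun z => max z.re.natAbs z.im.natAbs with hf
  have hnorm : ∀ z : GaussianInt, ((f z : ℕ) : ℤ) ^ 2 ≤ z.norm := by
    intro z
    rw [Zsqrtd.norm_def]
    rcases max_choice z.re.natAbs z.im.natAbs with h | h
    · simp only [hf, h, Int.natAbs_sq]
      nlinarith [mul_self_nonneg z.im]
    · simp only [hf, h, Int.natAbs_sq]
      nlinarith [mul_self_nonneg z.re]
  have hmaps : ∀ z ∈ Z, f z ∈ Finset.Icc 1 X := by
    intro z hz
    obtain ⟨h1, h2⟩ := hZ z hz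
    rw [Finset.mem_Icc]
    constructor
    · by_contra h0
      have h0' : f z = 0 := by omega
      have hre : z.re = 0 := by
        have : z.re.natAbs ≤ f z := le_max_left _ _
        omega
      have him : z.im = 0 := by
        have : z.im.natAbs ≤ f z := le_max_right _ _
        omega
      rw [Zsqrtd.norm_def, hre, him] at h1
      simp at h1
    · have := (hnorm z).trans h2
      exact_mod_cast (sq_le_sq₀ (by positivity) (by positivity)).1 this
  rw [← Finset.sum_fiberwise_of_maps_to hmaps]
  calc ∑ k ∈ Finset.Icc 1 X, ∑ z ∈ Z with f z = k, (1 : ℝ) / z.norm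
      ≤ ∑ k ∈ Finset.Icc 1 X, 8 * ((k : ℝ))⁻¹ := by
        refine Finset.sum_le_sum fun k hk => ?_
        have hk1 : 1 ≤ k := (Finset.mem_Icc.1 hk).1
        have hk0 : (0 : ℝ) < k := by exact_mod_cast hk1
        have hcard : (Finset.card {z ∈ Z | f z = k}) ≤ 8 * k := by
          rw [← Int.card_box (by omega : k ≠ 0)]
          refine Finset.card_le_card_of_injOn (fun z => (z.re, z.im)) (fun z hz => ?_)
            (fun z _ w _ h => Zsqrtd.ext (congrArg Prod.fst h) (congrArg Prod.snd h))
          have := (Finset.mem_filter.1 hz).2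
          simpa [Int.mem_box] using this
        calc ∑ z ∈ Z with f z = k, (1 : ℝ) / z.norm ≤ ∑ z ∈ Z with f z = k, 1 / (k : ℝ) ^ 2 := by
              refine Finset.sum_le_sum fun z hz => ?_
              have h := (Finset.mem_filter.1 hz).2
              have h1 := hnorm z
              rw [h] at h1
              have h2 : (k : ℝ) ^ 2 ≤ z.norm := by exact_mod_cast h1
              gcongr
          _ = (Finset.card {z ∈ Z | f z = k} : ℝ) * (1 / (k : ℝ) ^ 2) := by
              rw [Finset.sum_const, nsmul_eq_mul]
          _ ≤ (8 * k : ℝ) * (1 / (k : ℝ) ^ 2) := by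
              gcongr
              exact_mod_cast hcard
          _ = _ := by field_simp
    _ = 8 * ((harmonic X : ℚ) : ℝ) := by
        rw [← Finset.mul_sum, harmonic_eq_sum_Icc]
        push_cast
        rfl
    _ ≤ _ := by
        gcongr
        exact harmonic_le_one_add_log X

/-- Squaring the sum turns it into a sum over pairs `(a, b)`, which the injection
`(a, b) ↦ gaussianLift a * star (gaussianLift b)` compares with the sum of `1 / norm z` over
nonzero Gaussian integers of norm at most `X ^ 2`. -/
theorem sq_sum_splitNats_inv_le (X : ℕ) :
    (∑ m ∈ splitNats X, (1 : ℝ) / m) ^ 2 ≤ 8 * (1 + Real.log X) := by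
  classical
  set φ : ℕ × ℕ → GaussianInt := fun x => gaussianLift x.1 * star (gaussianLift x.2) with hφ
  have hsplit : ∀ {x}, x ∈ splitNats X ×ˢ splitNats X → IsSplitNat x.1 ∧ IsSplitNat x.2 :=
    fun hx => ⟨(mem_splitNats.1 (Finset.mem_product.1 hx).1).2,
      (mem_splitNats.1 (Finset.mem_product.1 hx).2).2⟩
  have hnorm : ∀ x ∈ splitNats X ×ˢ splitNats X, (φ x).norm = (x.1 : ℤ) * x.2 := by
    intro x hx
    rw [hφ, Zsqrtd.norm_mul, Zsqrtd.norm_conj, norm_gaussianLift (hsplit hx).1,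
      norm_gaussianLift (hsplit hx).2]
  have hinj : Set.InjOn φ (splitNats X ×ˢ splitNats X : Finset (ℕ × ℕ)) :=
    gaussianLift_mul_star_injOn.mono fun x hx => hsplit hx
  calc (∑ m ∈ splitNats X, (1 : ℝ) / m) ^ 2
      = ∑ x ∈ splitNats X ×ˢ splitNats X, (1 : ℝ) / (φ x).norm := by
        rw [sq, Finset.sum_mul_sum, ← Finset.sum_product']
        refine Finset.sum_congr rfl fun x hx => ?_
        rw [hnorm x hx]
        push_cast
        rw [one_div_mul_one_div]
    _ = ∑ z ∈ (splitNats X ×ˢ splitNats X).image φ, (1 : ℝ) / z.norm := by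
        rw [Finset.sum_image hinj]
    _ ≤ _ := by
        refine sum_inv_norm_le fun z hz => ?_
        obtain ⟨x, hx, rfl⟩ := Finset.mem_image.1 hz
        obtain ⟨⟨h1, h2⟩, -⟩ := mem_splitNats.1 (Finset.mem_product.1 hx).1
        obtain ⟨⟨h3, h4⟩, -⟩ := mem_splitNats.1 (Finset.mem_product.1 hx).2
        rw [hnorm x hx]
        constructor
        · exact_mod_cast Nat.mul_pos h1 h3
        · rw [sq]
          exact_mod_cast Nat.mul_le_mul h2 h4

/-- Writes `log n` as the sum of `Λ (n / m)` over the divisors `m` of `n`, which belong to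
`splitNats` again, exchanges the sums and applies Chebyshev's bound. -/
theorem sum_log_splitNats_le {Y : ℝ} (hY : 0 ≤ Y) :
    ∑ n ∈ splitNats ⌊Y⌋₊, Real.log n ≤
      (Real.log 4 + 4) * Y * ∑ m ∈ splitNats ⌊Y⌋₊, (1 : ℝ) / m := by
  classical
  set S := splitNats ⌊Y⌋₊ with hS
  calc ∑ n ∈ S, Real.log n
      = ∑ n ∈ S, ∑ m ∈ n.divisors, ArithmeticFunction.vonMangoldt (n / m) := by
        refine Finset.sum_congr rfl fun n _ => ?_
        rw [← ArithmeticFunction.vonMangoldt_sum, Nat.sum_div_divisors]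
    _ ≤ ∑ n ∈ S, ∑ m ∈ S with m ∣ n, ArithmeticFunction.vonMangoldt (n / m) := by
        refine Finset.sum_le_sum fun n hn => ?_
        refine Finset.sum_le_sum_of_subset_of_nonneg (fun m hm => ?_)
          fun _ _ _ => ArithmeticFunction.vonMangoldt_nonneg
        obtain ⟨⟨hn1, hn2⟩, hn3⟩ := mem_splitNats.1 hn
        have hmn := Nat.dvd_of_mem_divisors hm
        exact Finset.mem_filter.2 ⟨mem_splitNats.2 ⟨⟨Nat.pos_of_mem_divisors hm,
          (Nat.le_of_dvd hn1 hmn).trans hn2⟩, hn3.of_dvd hmn⟩, hmn⟩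
    _ = ∑ m ∈ S, ∑ n ∈ S with m ∣ n, ArithmeticFunction.vonMangoldt (n / m) := by
        simp only [Finset.sum_filter]
        exact Finset.sum_comm
    _ ≤ ∑ m ∈ S, Chebyshev.psi (Y / m) := by
        refine Finset.sum_le_sum fun m hm => ?_
        obtain ⟨⟨hm1, -⟩, -⟩ := mem_splitNats.1 hm
        have hinj : Set.InjOn (fun n => n / m) (Finset.filter (fun n => m ∣ n) S : Set ℕ) := by
          intro a ha b hb h
          have ha' := (Finset.mem_filter.1 ha).2
          have hb' := (Finset.mem_filter.1 hb).2
          rw [← Nat.div_mul_cancel ha', ← Nat.div_mul_cancel hb']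
          exact congrArg (· * m) h
        rw [← Finset.sum_image (f := fun d => ArithmeticFunction.vonMangoldt d) hinj, Chebyshev.psi]
        refine Finset.sum_le_sum_of_subset_of_nonneg (fun d hd => ?_)
          fun _ _ _ => ArithmeticFunction.vonMangoldt_nonneg
        obtain ⟨n, hn, rfl⟩ := Finset.mem_image.1 hd
        obtain ⟨hn1, hn2⟩ := Finset.mem_filter.1 hn
        obtain ⟨⟨hn3, hn4⟩, -⟩ := mem_splitNats.1 hn1
        rw [Finset.mem_Ioc, Nat.floor_div_natCast]
        exact ⟨Nat.div_pos (Nat.le_of_dvd hn3 hn2) hm1, Nat.div_le_div_right hn4⟩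
    _ ≤ ∑ m ∈ S, (Real.log 4 + 4) * (Y / m) :=
        Finset.sum_le_sum fun m _ => Chebyshev.psi_le_const_mul_self (by positivity)
    _ = _ := by
        rw [Finset.mul_sum]
        exact Finset.sum_congr rfl fun m _ => by ring

/-- The lower order parts of `log Y = log m + log (Y / m)` are absorbed by `log (Y / m) ≤ Y / m`, so
that the count times `1 + log Y` is at most a constant times `Y` times the sum of `1 / m`. -/
theorem exists_card_splitNats_le :
    ∃ C : ℝ, 0 < C ∧ ∀ Y : ℝ, 1 ≤ Y →
      ((splitNats ⌊Y⌋₊).card : ℝ) ≤ C * Y / √(1 + Real.log Y) := by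
  have hlog4 : 0 < Real.log 4 := Real.log_pos (by norm_num)
  refine ⟨(Real.log 4 + 6) * √8, by positivity, fun Y hY => ?_⟩
  have hY0 : 0 < Y := by linarith
  have hlogY : 0 ≤ Real.log Y := Real.log_nonneg hY
  set S := splitNats ⌊Y⌋₊ with hS
  set A := ∑ m ∈ S, (1 : ℝ) / m with hA
  have hmem : ∀ m ∈ S, (1 : ℝ) ≤ m ∧ (m : ℝ) ≤ Y := by
    intro m hm
    obtain ⟨⟨h1, h2⟩, -⟩ := mem_splitNats.1 hm
    exact ⟨by exact_mod_cast h1, (Nat.le_floor_iff hY0.le).1 h2⟩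
  have hA2 : A ≤ √8 * √(1 + Real.log Y) := by
    rw [← Real.sqrt_mul (by norm_num)]
    apply Real.le_sqrt_of_sq_le
    refine (sq_sum_splitNats_inv_le _).trans ?_
    have h1 : (1 : ℝ) ≤ (⌊Y⌋₊ : ℝ) := by exact_mod_cast Nat.one_le_floor_iff Y |>.2 hY
    have := Real.log_le_log (by linarith) (Nat.floor_le hY0.le)
    linarith
  have hcard : (S.card : ℝ) ≤ Y * A := by
    rw [hA, Finset.mul_sum, Finset.card_eq_sum_ones, Nat.cast_sum]
    refine Finset.sum_le_sum fun m hm => ?_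
    obtain ⟨h1, h2⟩ := hmem m hm
    rw [mul_one_div, Nat.cast_one, one_le_div (by linarith)]
    exact h2
  have hlog : (S.card : ℝ) * Real.log Y ≤ (Real.log 4 + 4) * Y * A + Y * A := by
    calc (S.card : ℝ) * Real.log Y = ∑ m ∈ S, Real.log m + ∑ m ∈ S, Real.log (Y / m) := by
          rw [← Finset.sum_add_distrib, ← nsmul_eq_mul, ← Finset.sum_const]
          refine Finset.sum_congr rfl fun m hm => ?_
          have h1 := (hmem m hm).1
          rw [Real.log_div hY0.ne' (by linarith)]
          ring
      _ ≤ _ := by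
          refine add_le_add (sum_log_splitNats_le hY0.le) ?_
          rw [hA, Finset.mul_sum]
          refine Finset.sum_le_sum fun m hm => ?_
          have h1 := (hmem m hm).1
          rw [mul_one_div]
          exact Real.log_le_self (by positivity)
  set L := 1 + Real.log Y with hL
  have hL0 : 0 < L := by linarith
  rw [le_div_iff₀ (Real.sqrt_pos.2 hL0)]
  have h1 : (S.card : ℝ) * L ≤ (Real.log 4 + 6) * Y * (√8 * √L) := by
    calc (S.card : ℝ) * L ≤ (Real.log 4 + 6) * Y * A := by rw [hL]; linarith
      _ ≤ _ := by gcongr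
  have h2 : √L * √L = L := Real.mul_self_sqrt hL0.le
  have h3 : 0 < √L := Real.sqrt_pos.2 hL0
  nth_rw 1 [← h2] at h1
  apply le_of_mul_le_mul_right _ h3
  linarith

/-! ### Counting sums of two squares -/

open Classical in
/-- The integers `1 ≤ N ≤ X` that are sums of two squares. -/
noncomputable def sumsOfTwoSquares (X : ℕ) : Finset ℕ :=
  {N ∈ Finset.Icc 1 X | ∃ x y : ℕ, N = x ^ 2 + y ^ 2}

/-- A factor of which `-1` is a quadratic residue is not divisible by `4` or by a prime `3` modulo
`4`, hence it satisfies `IsSplitNat` or is twice a number that does. -/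
theorem exists_eq_sq_mul_isSplitNat {N : ℕ} (hN : N ≠ 0) (h : ∃ x y : ℕ, N = x ^ 2 + y ^ 2) :
    ∃ a b : ℕ, IsSplitNat b ∧ (N = a ^ 2 * b ∨ N = 2 * (a ^ 2 * b)) := by
  obtain ⟨a, b, hab, hb⟩ := Nat.eq_sq_add_sq_iff_eq_sq_mul.1 h
  have hb0 : b ≠ 0 := by
    rintro rfl
    exact hN (by simpa using hab)
  have split_of_odd : ∀ c, c ∣ b → c % 2 = 1 → IsSplitNat c := by
    intro c hc h2
    have hc0 := ne_zero_of_dvd_ne_zero hb0 hc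
    refine ⟨hc0, fun p hp hpc => ?_⟩
    have h3 := Nat.mod_four_ne_three_of_mem_primeFactors_of_isSquare_neg_one
      (Nat.mem_primeFactors.2 ⟨hp, hpc.trans hc, hb0⟩) hb
    have h4 : p % 2 = 1 := Nat.odd_iff.1 (Odd.of_dvd_nat (Nat.odd_iff.2 h2) hpc)
    omega
  have h4 : ¬ 4 ∣ b := by
    intro h4
    have := ZMod.isSquare_neg_one_of_dvd h4 hb
    revert this
    decide
  rcases Nat.mod_two_eq_zero_or_one b with h2 | h2
  · obtain ⟨c, rfl⟩ := Nat.dvd_of_mod_eq_zero h2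
    exact ⟨a, c, split_of_odd c (Dvd.intro_left _ rfl) (by omega), Or.inr (by rw [hab]; ring)⟩
  · exact ⟨a, b, split_of_odd b dvd_rfl h2, Or.inl hab⟩

theorem card_sumsOfTwoSquares_le (X : ℕ) :
    (sumsOfTwoSquares X).card ≤ ∑ a ∈ Finset.Icc 1 X.sqrt, 2 * (splitNats (X / a ^ 2)).card := by
  classical
  have hsub : sumsOfTwoSquares X ⊆ (Finset.Icc 1 X.sqrt).biUnion fun a =>
      (splitNats (X / a ^ 2)).image (fun b => a ^ 2 * b) ∪
        (splitNats (X / a ^ 2)).image (fun b => 2 * (a ^ 2 * b)) := by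
    intro N hN
    obtain ⟨hN1, hN2⟩ := Finset.mem_filter.1 hN
    obtain ⟨hN3, hN4⟩ := Finset.mem_Icc.1 hN1
    obtain ⟨a, b, hb, h⟩ := exists_eq_sq_mul_isSplitNat (by omega) hN2
    have hab : 0 < a ^ 2 * b := by
      apply Nat.pos_of_ne_zero
      intro h0
      rcases h with h | h <;> omega
    have ha0 : 0 < a ^ 2 := Nat.pos_of_mul_pos_right hab
    have hb1 : 1 ≤ b := Nat.pos_of_ne_zero hb.1
    have hle : a ^ 2 * b ≤ X := by rcases h with h | h <;> omega
    have ha1 : 1 ≤ a := Nat.pos_of_ne_zero (by rintro rfl; simp at ha0)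
    have haX : a ≤ X.sqrt := Nat.le_sqrt'.2 ((Nat.le_mul_of_pos_right _ hb1).trans hle)
    have hbm : b ∈ splitNats (X / a ^ 2) :=
      mem_splitNats.2 ⟨⟨hb1, (Nat.le_div_iff_mul_le ha0).2 (by rwa [mul_comm])⟩, hb⟩
    refine Finset.mem_biUnion.2 ⟨a, Finset.mem_Icc.2 ⟨ha1, haX⟩, Finset.mem_union.2 ?_⟩
    rcases h with h | h
    · exact Or.inl (Finset.mem_image.2 ⟨b, hbm, h.symm⟩)
    · exact Or.inr (Finset.mem_image.2 ⟨b, hbm, h.symm⟩)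
  refine (Finset.card_le_card hsub).trans (Finset.card_biUnion_le.trans ?_)
  refine Finset.sum_le_sum fun a _ => (Finset.card_union_le _ _).trans ?_
  rw [two_mul]
  exact add_le_add Finset.card_image_le Finset.card_image_le

/-- The upper bound half of the Landau–Ramanujan theorem. -/
theorem exists_card_sumsOfTwoSquares_le :
    ∃ C : ℝ, 0 < C ∧ ∀ X : ℕ, 1 ≤ X →
      ((sumsOfTwoSquares X).card : ℝ) ≤ C * X / √(1 + Real.log X) := by
  obtain ⟨C, hC0, hC⟩ := exists_card_splitNats_le
  have hsum : Summable fun a : ℕ => 1 / (a : ℝ) ^ (3 / 2 : ℝ) :=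
    Real.summable_one_div_nat_rpow.2 (by norm_num)
  set T := ∑' a : ℕ, 1 / (a : ℝ) ^ (3 / 2 : ℝ) with hT
  have hT0 : 0 ≤ T := tsum_nonneg fun a => by positivity
  refine ⟨2 * C * √2 * (T + 1), by positivity, fun X hX => ?_⟩
  have hX1 : (1 : ℝ) ≤ X := by exact_mod_cast hX
  have hlogX : 0 ≤ Real.log X := Real.log_nonneg hX1
  have term : ∀ a ∈ Finset.Icc 1 X.sqrt, ((2 * (splitNats (X / a ^ 2)).card : ℕ) : ℝ) ≤
      2 * C * √2 * (X / √(1 + Real.log X)) * (1 / (a : ℝ) ^ (3 / 2 : ℝ)) := by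
    intro a ha
    obtain ⟨ha1, ha2⟩ := Finset.mem_Icc.1 ha
    have ha1' : (1 : ℝ) ≤ a := by exact_mod_cast ha1
    have ha0 : (0 : ℝ) < a := by linarith
    have ha2' : (a : ℝ) ^ 2 ≤ X := by exact_mod_cast Nat.le_sqrt'.1 ha2
    have hY : 1 ≤ (X : ℝ) / (a : ℝ) ^ 2 := by rwa [one_le_div (by positivity)]
    have hfl : ⌊(X : ℝ) / (a : ℝ) ^ 2⌋₊ = X / a ^ 2 := by
      rw [← Nat.cast_pow, Nat.floor_div_eq_div]
    have h1 := hC _ hY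
    rw [hfl] at h1
    have hloga : 0 ≤ Real.log a := Real.log_nonneg ha1'
    have hlogY : 0 ≤ Real.log ((X : ℝ) / (a : ℝ) ^ 2) := Real.log_nonneg hY
    -- `1 + log X ≤ (1 + log (X / a ^ 2)) * (1 + log (a ^ 2))`, and `1 + log (a ^ 2) ≤ 2 * a`
    have hprod : 1 + Real.log X ≤ (1 + Real.log ((X : ℝ) / (a : ℝ) ^ 2)) * (2 * a) := by
      have h2 : Real.log ((X : ℝ) / (a : ℝ) ^ 2) = Real.log X - 2 * Real.log a := by
        rw [Real.log_div (by positivity) (by positivity), Real.log_pow]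
        norm_num
      have h3 : 1 + 2 * Real.log a ≤ 2 * a := by
        have := Real.log_le_sub_one_of_pos ha0
        linarith
      calc 1 + Real.log X ≤
            (1 + Real.log ((X : ℝ) / (a : ℝ) ^ 2)) * (1 + 2 * Real.log a) := by
            nlinarith [mul_nonneg hlogY hloga]
        _ ≤ _ := by gcongr
    have hsq : √(1 + Real.log X) ≤
        √(1 + Real.log ((X : ℝ) / (a : ℝ) ^ 2)) * (√2 * (a : ℝ) ^ (1 / 2 : ℝ)) := by
      rw [← Real.sqrt_eq_rpow, ← Real.sqrt_mul two_pos.le, ← Real.sqrt_mul (by linarith)]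
      exact Real.sqrt_le_sqrt hprod
    have hpow : (a : ℝ) ^ 2 = (a : ℝ) ^ (1 / 2 : ℝ) * (a : ℝ) ^ (3 / 2 : ℝ) := by
      rw [← Real.rpow_add ha0, ← Real.rpow_natCast]
      norm_num
    have hs1 : 0 < √(1 + Real.log X) := Real.sqrt_pos.2 (by linarith)
    have hs2 : 0 < √(1 + Real.log ((X : ℝ) / (a : ℝ) ^ 2)) := Real.sqrt_pos.2 (by linarith)
    have ha3 : 0 < (a : ℝ) ^ (1 / 2 : ℝ) := by positivity
    have ha4 : 0 < (a : ℝ) ^ (3 / 2 : ℝ) := by positivity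
    push_cast
    generalize √(1 + Real.log ((X : ℝ) / (a : ℝ) ^ 2)) = s at *
    generalize √(1 + Real.log X) = t at *
    rw [hpow] at h1
    generalize (a : ℝ) ^ (1 / 2 : ℝ) = u at *
    generalize (a : ℝ) ^ (3 / 2 : ℝ) = v at *
    have hinv : 1 / (s * u) ≤ √2 / t := by
      rw [div_le_div_iff₀ (by positivity) hs1]
      linarith
    calc 2 * ((splitNats (X / a ^ 2)).card : ℝ) ≤ 2 * (C * (X / (u * v)) / s) := by gcongr
      _ = 2 * C * X / v * (1 / (s * u)) := by field_simp
      _ ≤ 2 * C * X / v * (√2 / t) := mul_le_mul_of_nonneg_left hinv (by positivity)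
      _ = _ := by field_simp
  calc ((sumsOfTwoSquares X).card : ℝ)
      ≤ ∑ a ∈ Finset.Icc 1 X.sqrt, ((2 * (splitNats (X / a ^ 2)).card : ℕ) : ℝ) := by
        exact_mod_cast card_sumsOfTwoSquares_le X
    _ ≤ ∑ a ∈ Finset.Icc 1 X.sqrt,
          2 * C * √2 * (X / √(1 + Real.log X)) * (1 / (a : ℝ) ^ (3 / 2 : ℝ)) :=
        Finset.sum_le_sum term
    _ = 2 * C * √2 * (X / √(1 + Real.log X)) *
          ∑ a ∈ Finset.Icc 1 X.sqrt, 1 / (a : ℝ) ^ (3 / 2 : ℝ) := by rw [Finset.mul_sum]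
    _ ≤ 2 * C * √2 * (X / √(1 + Real.log X)) * (T + 1) := by
        gcongr
        have := hsum.sum_le_tsum (Finset.Icc 1 X.sqrt) fun a _ => by positivity
        linarith
    _ = _ := by ring

/-! ### The covering number -/

/-- Circles centred at the origin cover the grid; their squared radii are sums of two squares. -/
theorem geometricCoveringNumber_squareGrid_le (n : ℕ) :
    geometricCoveringNumber planeCircles (squareGrid n) ≤ (sumsOfTwoSquares (2 * n ^ 2)).card := by
  classical
  set F : Set (Set (EuclideanSpace ℝ (Fin 2))) :=
    (fun N : ℕ => Metric.sphere 0 √(N : ℝ)) '' (sumsOfTwoSquares (2 * n ^ 2) : Set ℕ) with hF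
  have hFC : F ⊆ planeCircles := by
    rintro _ ⟨N, hN, rfl⟩
    have hN1 : 1 ≤ N := (Finset.mem_Icc.1 (Finset.mem_filter.1 hN).1).1
    exact ⟨0, √(N : ℝ), Real.sqrt_pos.2 (by exact_mod_cast hN1), rfl⟩
  have hcov : squareGrid n ⊆ ⋃₀ F := by
    intro p hp
    obtain ⟨k, hk1, hk2, hk⟩ := hp 0
    obtain ⟨l, hl1, hl2, hl⟩ := hp 1
    refine ⟨_, ⟨k ^ 2 + l ^ 2, ?_, rfl⟩, ?_⟩
    · refine Finset.mem_filter.2 ⟨Finset.mem_Icc.2 ⟨?_, ?_⟩, k, l, rfl⟩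
      · nlinarith
      · nlinarith [Nat.pow_le_pow_left hk2 2, Nat.pow_le_pow_left hl2 2]
    · rw [mem_sphere_zero_iff_norm, EuclideanSpace.norm_eq, Fin.sum_univ_two, hk, hl]
      simp
  calc geometricCoveringNumber planeCircles (squareGrid n) ≤ F.encard :=
        iInf_le (fun F : {F : Set (Set (EuclideanSpace ℝ (Fin 2))) //
          F ⊆ planeCircles ∧ squareGrid n ⊆ ⋃₀ F} => F.1.encard) ⟨F, hFC, hcov⟩
    _ ≤ (sumsOfTwoSquares (2 * n ^ 2) : Set ℕ).encard := Set.encard_image_le _ _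
    _ = _ := Set.encard_coe_eq_coe_finsetCard _

theorem mainTheorem9 :
    (∀ n : ℕ, geometricCoveringNumber planeCircles (squareGrid n) ≠ ⊤) ∧
    (∀ ε : ℝ, 0 < ε →
      Asymptotics.IsBigO Filter.atTop
        (fun n : ℕ => (n : ℝ) ^ (2 - ε))
        (fun n : ℕ => ((geometricCoveringNumber planeCircles (squareGrid n)).toNat : ℝ))) ∧
    Asymptotics.IsBigO Filter.atTop
      (fun n : ℕ => ((geometricCoveringNumber planeCircles (squareGrid n)).toNat : ℝ))
      (fun n : ℕ => (n : ℝ) ^ 2 / Real.sqrt (Real.log (n : ℝ))) := by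
  have hfin : ∀ n : ℕ, geometricCoveringNumber planeCircles (squareGrid n) ≠ ⊤ := fun n =>
    ne_top_of_le_ne_top (ENat.natCast_ne_top _) (geometricCoveringNumber_squareGrid_le n)
  refine ⟨hfin, fun ε hε => ?_, ?_⟩
  · obtain ⟨C, hC0, hC⟩ := exists_ncard_circle_inter_squareGrid_le hε
    refine Asymptotics.IsBigO.of_bound C ?_
    filter_upwards [Filter.eventually_ge_atTop 1] with n hn
    have hn0 : (0 : ℝ) < n := by exact_mod_cast hn
    have h := sq_le_encard_toNat_mul (hC n hn) (hfin n)
    rw [Real.norm_of_nonneg (by positivity), Real.norm_of_nonneg (by positivity),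
      Real.rpow_sub hn0, div_le_iff₀ (by positivity), Real.rpow_two]
    linarith
  · obtain ⟨C, hC0, hC⟩ := exists_card_sumsOfTwoSquares_le
    refine Asymptotics.IsBigO.of_bound (2 * C) ?_
    filter_upwards [Filter.eventually_ge_atTop 2] with n hn
    have hn2 : (2 : ℝ) ≤ n := by exact_mod_cast hn
    have hlog : 0 < Real.log n := Real.log_pos (by linarith)
    have hX : 1 ≤ 2 * n ^ 2 := by nlinarith
    rw [Real.norm_of_nonneg (by positivity), Real.norm_of_nonneg (by positivity)]
    calc ((geometricCoveringNumber planeCircles (squareGrid n)).toNat : ℝ)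
        ≤ ((sumsOfTwoSquares (2 * n ^ 2)).card : ℝ) := by
          exact_mod_cast ENat.toNat_le_of_le_natCast (geometricCoveringNumber_squareGrid_le n)
      _ ≤ C * ((2 * n ^ 2 : ℕ) : ℝ) / √(1 + Real.log ((2 * n ^ 2 : ℕ) : ℝ)) := hC _ hX
      _ ≤ C * ((2 * n ^ 2 : ℕ) : ℝ) / √(Real.log n) := by
          have hle : Real.log n ≤ 1 + Real.log ((2 * n ^ 2 : ℕ) : ℝ) := by
            have : Real.log n ≤ Real.log ((2 * n ^ 2 : ℕ) : ℝ) := by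
              apply Real.log_le_log (by linarith)
              push_cast
              nlinarith
            linarith
          have hs : 0 < √(Real.log n) := Real.sqrt_pos.2 hlog
          gcongr
      _ = _ := by
          push_cast
          ring
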